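/- Let $K$ be an algebraically closed field, let $n\ge 0$ be an integer, let $X=(x_{ij})_{1\le i,j\le n}$ be a matrix of independent indeterminates, and let $K[X]$ be the polynomial ring over $K$ in the $n^2$ variables $x_{ij}$. Let $P_2\subseteq K[X]$ be the ideal generated by the principal $2\times 2$ minors $x_{ii}x_{jj}-x_{ij}x_{ji}$ $(1\le i<j\le n)$ of $X$. Then $K[X]/P_2$ is a complete intersection (a quotient of a polynomial ring in finitely many variables over $K$ by an ideal generated by a regular sequence) and an integral domain. More precisely, the $\binom n2$ principal $2$-minors, taken in any order, form a regular sequence in $K[X]$, and the ideal $P_2$ is toric: for some $d\ge 0$ and some submonoid $S\subseteq\mathbb Z^d$ there is an isomorphism of $K$-algebras from $K[X]/P_2$ to the semigroup ring $K[S]$ that sends the class of each variable $x_{ij}$ to a monomial (an element of $S$). -/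

import Mathlib

/-- The principal minor of a square matrix `M` on the index set `s`: the determinant of the
submatrix with row indices and column indices both equal to `s`. -/
def principalMinor {n : ℕ} {R : Type*} [CommRing R] (M : Matrix (Fin n) (Fin n) R)
    (s : Finset (Fin n)) : R :=
  (M.submatrix (fun i : s => (i : Fin n)) (fun i : s => (i : Fin n))).det

/-- The ideal generated by the principal minors of size `t` of a square matrix. -/
def principalMinorIdeal {n : ℕ} {R : Type*} [CommRing R] (M : Matrix (Fin n) (Fin n) R)
    (t : ℕ) : Ideal R :=
  Ideal.span {f | ∃ s : Finset (Fin n), s.card = t ∧ principalMinor M s = f}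

/-- The ideal `P_t` of the polynomial ring `K[x_ij]` generated by the principal minors of size `t`
of the generic matrix `X = (x_ij)`. -/
noncomputable def genericPrincipalMinorIdeal (K : Type*) [Field K] (n t : ℕ) :
    Ideal (MvPolynomial (Fin n × Fin n) K) :=
  principalMinorIdeal (Matrix.mvPolynomialX (Fin n) (Fin n) K) t

/-- A `K`-algebra is a complete intersection if it is a quotient of a polynomial ring in finitely
many variables over `K` by an ideal generated by a regular sequence. -/
def IsCompleteIntersection (K A : Type*) [Field K] [CommRing A] [Algebra K A] : Prop :=
  ∃ (σ : Type) (_ : Finite σ) (rs : List (MvPolynomial σ K)),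
    RingTheory.Sequence.IsRegular (MvPolynomial σ K) rs ∧
      Nonempty ((MvPolynomial σ K ⧸ Ideal.ofList rs) ≃ₐ[K] A)

/-- An ideal `I` of a polynomial ring over `K` is toric if the quotient by `I` is isomorphic to the
semigroup ring `K[S]` of a submonoid `S` of a lattice `ℤ^d`, in such a way that the classes of the
variables correspond to monomials. (As the classes of the variables generate the quotient, their
exponents then generate `S`.) -/
def IsToricIdeal {σ K : Type*} [Field K] (I : Ideal (MvPolynomial σ K)) : Prop :=
  ∃ (d : ℕ) (S : AddSubmonoid (Fin d → ℤ))
    (e : (MvPolynomial σ K ⧸ I) ≃ₐ[K] AddMonoidAlgebra K S),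
    ∀ i : σ, ∃ s : S, e (Ideal.Quotient.mk I (MvPolynomial.X i)) = AddMonoidAlgebra.single s 1

open MvPolynomial

/-! For every set `E` of pairs `i < j`, the minors indexed by `E` generate the kernel of the
monomial map `x_ji ↦ x_ii x_jj / x_ij`, `(i, j) ∈ E`: modulo these minors each monomial reduces to
one divisible by no `x_ij x_ji`, and the map separates reduced monomials. The ideal is therefore
prime, and it omits every minor outside `E`. Applied to the initial segments of any ordering, this
gives regularity; applied to all pairs, the toric presentation. -/

/-- Replacing each monomial by a chosen representative of its fibre under `g` changes `f` only by an
element of `I`, and the result depends only on the image of `f`. -/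
theorem AddMonoidAlgebra.ker_mapDomainAlgHom_le {σ K S : Type*} [CommRing K] [AddCommMonoid S]
    (g : (σ →₀ ℕ) →+ S) (I : Ideal (MvPolynomial σ K))
    (hI : ∀ a b, g a = g b → monomial a (1 : K) - monomial b 1 ∈ I) :
    RingHom.ker (AddMonoidAlgebra.mapDomainAlgHom K K g) ≤ I := by
  intro f hf
  set s := Function.invFun g with hs
  have key : ∀ f : MvPolynomial σ K,
      f - AddMonoidAlgebra.mapDomain s (AddMonoidAlgebra.mapDomain g f) ∈ I := by
    intro f
    induction f using MvPolynomial.induction_on' with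
    | monomial a c =>
      have h1 : AddMonoidAlgebra.mapDomain s (AddMonoidAlgebra.mapDomain g (monomial a c)) =
          monomial (s (g a)) c := by
        simp [monomial, AddMonoidAlgebra.mapDomain_single]
      have h2 : g a = g (s (g a)) := (Function.invFun_eq ⟨a, rfl⟩).symm
      have h3 := I.mul_mem_left (C c) (hI _ _ h2)
      rwa [mul_sub, C_mul_monomial, C_mul_monomial, mul_one, ← h1] at h3
    | add p q hp hq =>
      rw [AddMonoidAlgebra.mapDomain_add, AddMonoidAlgebra.mapDomain_add, add_sub_add_comm]
      exact I.add_mem hp hq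
  have h := key f
  rw [RingHom.mem_ker] at hf
  have hf' : AddMonoidAlgebra.mapDomain g f = 0 := hf
  rwa [hf', AddMonoidAlgebra.mapDomain_zero, sub_zero] at h

/-! ### Ideals of principal 2-minors on a set of pairs -/

section Pairs

variable {ι : Type*}

/-- The principal 2-minor of the generic matrix on the rows and columns `p.1` and `p.2`. -/
noncomputable def pairMinor (K : Type*) [CommRing K] (p : ι × ι) : MvPolynomial (ι × ι) K :=
  X (p.1, p.1) * X (p.2, p.2) - X p * X p.swap

theorem pairMinor_eq (K : Type*) [CommRing K] (p : ι × ι) :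
    pairMinor K p = monomial (.single (p.1, p.1) 1 + .single (p.2, p.2) 1) 1 -
      monomial (.single p 1 + .single p.swap 1) 1 := by
  simp [pairMinor, X, monomial_mul]

/-- The ideal generated by the principal 2-minors on the pairs in `E`. -/
noncomputable def pairMinorIdeal (K : Type*) [CommRing K] (E : Finset (ι × ι)) :
    Ideal (MvPolynomial (ι × ι) K) :=
  Ideal.span (pairMinor K '' (E : Set (ι × ι)))

variable [LinearOrder ι]

/-- The exponent map of the monomial parametrization associated with `E`: for `(i, j) ∈ E` the
variable `x_ji` is sent to `x_ii x_jj / x_ij`, and every other variable is sent to itself. -/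
def pairExponent (E : Finset (ι × ι)) : (ι × ι →₀ ℕ) →+ (ι × ι → ℤ) where
  toFun a q :=
    if q.1 = q.2 then a q + ∑ p ∈ E with p.1 = q.1 ∨ p.2 = q.1, (a p.swap : ℤ)
    else if q ∈ E then a q - a q.swap
    else if q.swap ∈ E then 0 else a q
  map_zero' := by
    ext q
    simp
  map_add' a b := by
    ext q
    simp only [Finsupp.add_apply, Pi.add_apply, Nat.cast_add, Finset.sum_add_distrib]
    split_ifs <;> ring

theorem pairExponent_apply (E : Finset (ι × ι)) (a : ι × ι →₀ ℕ) (q : ι × ι) :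
    pairExponent E a q =
      if q.1 = q.2 then a q + ∑ p ∈ E with p.1 = q.1 ∨ p.2 = q.1, (a p.swap : ℤ)
      else if q ∈ E then (a q - a q.swap : ℤ)
      else if q.swap ∈ E then 0 else (a q : ℤ) := rfl

variable {E : Finset (ι × ι)}

theorem pairExponent_relation (hE : ∀ p ∈ E, p.1 < p.2) {p : ι × ι} (hp : p ∈ E) :
    pairExponent E (.single p 1 + .single p.swap 1) =
      pairExponent E (.single (p.1, p.1) 1 + .single (p.2, p.2) 1) := by
  obtain ⟨i, j⟩ := p
  have hij : i < j := hE _ hp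
  have hji : (j, i) ∉ E := fun h => (hE _ h).not_gt hij
  ext ⟨k, l⟩
  rw [pairExponent_apply, pairExponent_apply]
  by_cases hkl : k = l
  · subst hkl
    have h1 : ∀ q ∈ E.filter (fun p => p.1 = k ∨ p.2 = k),
        (((Finsupp.single (i, j) 1 + Finsupp.single (i, j).swap 1 : ι × ι →₀ ℕ) q.swap : ℕ) : ℤ) =
          if q = (i, j) then 1 else 0 := by
      rintro ⟨u, v⟩ hq
      have huv : u < v := hE _ (Finset.mem_filter.1 hq).1
      have h : ¬ (i = v ∧ j = u) := by
        rintro ⟨rfl, rfl⟩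
        exact huv.not_gt hij
      simp [Finsupp.single_apply, h, and_comm, eq_comm]
    have h2 : ∀ q ∈ E.filter (fun p => p.1 = k ∨ p.2 = k),
        (((Finsupp.single (i, i) 1 + Finsupp.single (j, j) 1 : ι × ι →₀ ℕ) q.swap : ℕ) : ℤ) =
          0 := by
      rintro ⟨u, v⟩ hq
      have huv : u < v := hE _ (Finset.mem_filter.1 hq).1
      have h : ∀ w, ¬ (w = v ∧ w = u) := by
        rintro w ⟨rfl, rfl⟩
        exact huv.false
      simp [h]
    simp only [if_true]
    rw [Finset.sum_congr rfl h1, Finset.sum_congr rfl h2, Finset.sum_ite_eq']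
    have hi : ¬ (i = k ∧ j = k) := by
      rintro ⟨rfl, rfl⟩
      exact hij.false
    have hi' : ¬ (j = k ∧ i = k) := fun h => hi h.symm
    simp only [Finsupp.add_apply, Finsupp.single_apply, Finset.mem_filter, hp, Prod.mk.injEq,
      Prod.swap_prod_mk, hi, hi', if_false, true_and, and_self, Finset.sum_const_zero]
    by_cases h1 : i = k <;> by_cases h2 : j = k <;> simp_all
  · have h0 : ∀ w, ¬ (w = k ∧ w = l) := by
      rintro w ⟨rfl, rfl⟩
      exact hkl rfl
    have h0' : ∀ w, ¬ (w = l ∧ w = k) := fun w h => h0 w h.symm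
    simp only [hkl, if_false, Finsupp.add_apply, Finsupp.single_apply, Prod.mk.injEq, h0, h0',
      Prod.swap_prod_mk]
    by_cases h1 : i = k ∧ j = l
    · obtain ⟨rfl, rfl⟩ := h1
      simp [hp, hij.ne, hij.ne']
    · by_cases h2 : j = k ∧ i = l
      · obtain ⟨rfl, rfl⟩ := h2
        simp [hp, hji]
      · have h1' : ¬ (j = l ∧ i = k) := fun h => h1 h.symm
        have h2' : ¬ (i = l ∧ j = k) := fun h => h2 h.symm
        simp [h1, h2, h1', h2']

/-- The coordinate at `p ∈ E` is `a p - a p.swap`; as one of the two vanishes, it determines both.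
The diagonal exponents follow by subtraction. -/
theorem pairExponent_injOn (hE : ∀ p ∈ E, p.1 < p.2) :
    Set.InjOn (pairExponent E) {a | ∀ p ∈ E, a p = 0 ∨ a p.swap = 0} := by
  intro a ha b hb hab
  have happ := fun q => congrFun hab q
  simp only [pairExponent_apply] at happ
  have hpair : ∀ p ∈ E, a p = b p ∧ a p.swap = b p.swap := by
    intro p hp
    have h := happ p
    rw [if_neg (hE p hp).ne, if_neg (hE p hp).ne, if_pos hp, if_pos hp] at h
    have h1 := ha p hp
    have h2 := hb p hp
    omega
  ext q
  have h := happ q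
  by_cases hq : q.1 = q.2
  · rw [if_pos hq, if_pos hq, Finset.sum_congr rfl fun p hp => by
      rw [(hpair p (Finset.mem_filter.1 hp).1).2]] at h
    exact_mod_cast add_right_cancel h
  · by_cases h1 : q ∈ E
    · exact (hpair q h1).1
    · by_cases h2 : q.swap ∈ E
      · simpa using (hpair _ h2).2
      · simpa [hq, h1, h2] using h

theorem exists_reduced (K : Type*) [CommRing K] (hE : ∀ p ∈ E, p.1 < p.2) (a : ι × ι →₀ ℕ) :
    ∃ b : ι × ι →₀ ℕ, (∀ p ∈ E, b p = 0 ∨ b p.swap = 0) ∧ pairExponent E a = pairExponent E b ∧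
      monomial a (1 : K) - monomial b 1 ∈ pairMinorIdeal K E := by
  -- Replacing `x_ij x_ji` by `x_ii x_jj` lowers this sum, since `E` has no diagonal pair.
  induction hN : ∑ p ∈ E, a p using Nat.strong_induction_on generalizing a with
  | _ N ih =>
  by_cases ha : ∀ p ∈ E, a p = 0 ∨ a p.swap = 0
  · exact ⟨a, ha, rfl, by simp⟩
  push Not at ha
  obtain ⟨p, hp, h1, h2⟩ := ha
  have hne : p ≠ p.swap := fun h => (hE p hp).ne (congrArg Prod.fst h)
  have hle : Finsupp.single p 1 + Finsupp.single p.swap 1 ≤ a := by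
    intro q
    by_cases hq : p = q
    · subst hq
      simp [hne.symm]
      omega
    · by_cases hq' : p.swap = q
      · subst hq'
        simp [hne]
        omega
      · simp [hq, hq']
  obtain ⟨c, rfl⟩ := exists_add_of_le hle
  have hlt : ∑ q ∈ E, (Finsupp.single (p.1, p.1) 1 + Finsupp.single (p.2, p.2) 1 + c : ι × ι →₀ ℕ) q < N := by
    rw [← hN]
    have hd : ∀ q ∈ E, ∀ k, (Finsupp.single (k, k) 1 : ι × ι →₀ ℕ) q = 0 := by
      rintro q hq k
      rw [Finsupp.single_apply, if_neg]
      rintro rfl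
      exact (hE _ hq).false
    apply Finset.sum_lt_sum
    · intro q hq
      simp [hd q hq]
    · refine ⟨p, hp, ?_⟩
      simp only [Finsupp.add_apply, hd p hp, Finsupp.single_eq_same]
      omega
  obtain ⟨b, hb, hgb, hmb⟩ := ih _ hlt _ rfl
  refine ⟨b, hb, ?_, ?_⟩
  · rw [← hgb, map_add, map_add (pairExponent E) _ c, pairExponent_relation hE hp]
  · have hm : pairMinor K p ∈ pairMinorIdeal K E := Ideal.subset_span ⟨p, hp, rfl⟩
    have := Ideal.sub_mem _ hmb (Ideal.mul_mem_left _ (monomial c 1) hm)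
    convert this using 1
    have hmul : ∀ a b : ι × ι →₀ ℕ, monomial (a + b) (1 : K) = monomial a 1 * monomial b 1 := by
      intro a b
      rw [monomial_mul, one_mul]
    simp only [pairMinor, X, hmul]
    ring

/-- The monomial parametrization associated with `E`. -/
noncomputable def pairToric (K : Type*) [CommRing K] (E : Finset (ι × ι)) :
    MvPolynomial (ι × ι) K →ₐ[K] AddMonoidAlgebra K (ι × ι → ℤ) :=
  AddMonoidAlgebra.mapDomainAlgHom K K (pairExponent E)

theorem pairToric_monomial (K : Type*) [CommRing K] (a : ι × ι →₀ ℕ) :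
    pairToric K E (monomial a 1) = AddMonoidAlgebra.single (pairExponent E a) 1 := by
  simp [pairToric, monomial, AddMonoidAlgebra.mapDomain_single]

/-- Only the fibres of the exponent map matter, so its target may later be reindexed and cut down to
its range. -/
theorem ker_mapDomainAlgHom_eq_pairMinorIdeal {S : Type*} [AddCommMonoid S] (K : Type*)
    [CommRing K] (hE : ∀ p ∈ E, p.1 < p.2) (g : (ι × ι →₀ ℕ) →+ S)
    (hg : ∀ a b, g a = g b ↔ pairExponent E a = pairExponent E b) :
    RingHom.ker (AddMonoidAlgebra.mapDomainAlgHom K K g) = pairMinorIdeal K E := by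
  apply le_antisymm
  · apply AddMonoidAlgebra.ker_mapDomainAlgHom_le
    intro a b hab
    obtain ⟨a', ha', hga, hma⟩ := exists_reduced K hE a
    obtain ⟨b', hb', hgb, hmb⟩ := exists_reduced K hE b
    have : a' = b' := pairExponent_injOn hE ha' hb' (hga ▸ hgb ▸ (hg a b).1 hab)
    subst this
    simpa using Ideal.sub_mem _ hma hmb
  rw [pairMinorIdeal, Ideal.span_le]
  rintro _ ⟨p, hp, rfl⟩
  rw [SetLike.mem_coe, RingHom.mem_ker, pairMinor_eq, map_sub, sub_eq_zero]
  simpa [monomial, AddMonoidAlgebra.mapDomain_single] using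
    congrArg (AddMonoidAlgebra.single · (1 : K)) ((hg _ _).2 (pairExponent_relation hE hp)).symm

theorem ker_pairToric (K : Type*) [CommRing K] (hE : ∀ p ∈ E, p.1 < p.2) :
    RingHom.ker (pairToric K E) = pairMinorIdeal K E :=
  ker_mapDomainAlgHom_eq_pairMinorIdeal K hE _ fun _ _ => Iff.rfl

theorem pairMinorIdeal_isPrime (K : Type*) [CommRing K] [IsDomain K]
    (hE : ∀ p ∈ E, p.1 < p.2) : (pairMinorIdeal K E).IsPrime := by
  rw [← ker_pairToric K hE]
  exact RingHom.ker_isPrime _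

theorem pairMinor_notMem (K : Type*) [CommRing K] [Nontrivial K] (hE : ∀ p ∈ E, p.1 < p.2)
    {p : ι × ι} (hp : p.1 < p.2) (hpE : p ∉ E) : pairMinor K p ∉ pairMinorIdeal K E := by
  rw [← ker_pairToric K hE, RingHom.mem_ker, pairMinor_eq, map_sub, pairToric_monomial,
    pairToric_monomial, sub_eq_zero]
  intro h
  -- At coordinate `p` the diagonal term has exponent 0 and the other term has exponent 1.
  have h1 := congrFun (AddMonoidAlgebra.single_left_injective one_ne_zero h) p
  have h2 : p.swap ∉ E := fun h => (hE _ h).not_gt hp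
  have hne : p.swap ≠ p := fun h => hp.ne' (congrArg Prod.fst h)
  have h3 : ∀ k, (k, k) ≠ p := by
    rintro k rfl
    exact hp.false
  simp [pairExponent_apply, hp.ne, hpE, h2, hne, h3] at h1

end Pairs
section Pairs

variable {ι : Type*} [LinearOrder ι]

theorem pairMinorIdeal_isToric [Finite ι] (K : Type*) [Field K] {E : Finset (ι × ι)}
    (hE : ∀ p ∈ E, p.1 < p.2) : IsToricIdeal (pairMinorIdeal K E) := by
  obtain ⟨d, ⟨e⟩⟩ := Finite.exists_equiv_fin (ι × ι)
  let g₀ : (ι × ι →₀ ℕ) →+ (Fin d → ℤ) :=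
    (LinearEquiv.funCongrLeft ℤ ℤ e.symm).toLinearMap.toAddMonoidHom.comp (pairExponent E)
  have hker : RingHom.ker (AddMonoidAlgebra.mapDomainAlgHom K K g₀.mrangeRestrict) =
      pairMinorIdeal K E := by
    apply ker_mapDomainAlgHom_eq_pairMinorIdeal K hE
    intro a b
    rw [Subtype.ext_iff]
    exact (LinearEquiv.funCongrLeft ℤ ℤ e.symm).injective.eq_iff
      (a := pairExponent E a) (b := pairExponent E b)
  have hsurj : Function.Surjective
      (AddMonoidAlgebra.mapDomainAlgHom K K g₀.mrangeRestrict) := by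
    intro x
    induction x using AddMonoidAlgebra.induction_linear with
    | zero => exact ⟨0, map_zero _⟩
    | add x y hx hy =>
      obtain ⟨a, rfl⟩ := hx
      obtain ⟨b, rfl⟩ := hy
      exact ⟨a + b, map_add _ _ _⟩
    | single s c =>
      obtain ⟨a, rfl⟩ := g₀.mrangeRestrict_surjective s
      exact ⟨AddMonoidAlgebra.single a c, by simp⟩
  refine ⟨d, AddMonoidHom.mrange g₀, (Ideal.quotientEquivAlgOfEq K hker.symm).trans
    (Ideal.quotientKerAlgEquivOfSurjective hsurj), fun q => ⟨g₀.mrangeRestrict (.single q 1), ?_⟩⟩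
  change AddMonoidAlgebra.mapDomainAlgHom K K g₀.mrangeRestrict (X q) = _
  simp [X, monomial]

end Pairs

/-! ### From 2-subsets to increasing pairs, and regularity -/

theorem principalMinor_eq_pairMinor (K : Type*) [Field K] {n : ℕ} {s : Finset (Fin n)}
    (hs : s.card = 2) : ∃ p : Fin n × Fin n, p.1 < p.2 ∧ s = {p.1, p.2} ∧
      principalMinor (Matrix.mvPolynomialX (Fin n) (Fin n) K) s = pairMinor K p := by
  let e := s.orderIsoOfFin hs
  refine ⟨(e 0, e 1), ?_, ?_, ?_⟩
  · simp
  · ext x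
    simp only [Finset.mem_insert, Finset.mem_singleton]
    constructor
    · intro hx
      obtain ⟨i, hi⟩ := e.surjective ⟨x, hx⟩
      have hx' : x = e i := by rw [hi]
      fin_cases i
      · exact Or.inl hx'
      · exact Or.inr hx'
    · rintro (rfl | rfl) <;> exact Subtype.property _
  · rw [principalMinor, ← Matrix.det_submatrix_equiv_self e.toEquiv, Matrix.det_fin_two]
    simp [pairMinor]

/-- The increasing pairs of indices whose underlying set occurs in `l`. -/
def increasingPairs {n : ℕ} (l : List (Finset (Fin n))) : Finset (Fin n × Fin n) :=
  {p | p.1 < p.2 ∧ {p.1, p.2} ∈ l}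

theorem mem_increasingPairs {n : ℕ} {l : List (Finset (Fin n))} {p : Fin n × Fin n} :
    p ∈ increasingPairs l ↔ p.1 < p.2 ∧ {p.1, p.2} ∈ l := by
  simp [increasingPairs]

theorem lt_of_mem_increasingPairs {n : ℕ} {l : List (Finset (Fin n))} :
    ∀ p ∈ increasingPairs l, p.1 < p.2 := fun _ hp => (mem_increasingPairs.1 hp).1

theorem eq_of_pair_eq_pair {ι : Type*} [LinearOrder ι] {p q : ι × ι} (hp : p.1 < p.2)
    (hq : q.1 < q.2) (h : ({p.1, p.2} : Finset ι) = {q.1, q.2}) : p = q := by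
  obtain ⟨a, b⟩ := p
  obtain ⟨c, d⟩ := q
  have h1 : a ∈ ({c, d} : Finset ι) := h ▸ by simp
  have h2 : b ∈ ({c, d} : Finset ι) := h ▸ by simp
  simp only [Finset.mem_insert, Finset.mem_singleton] at h1 h2 hp hq
  rcases h1 with rfl | rfl <;> rcases h2 with rfl | rfl
  · exact (hp.false).elim
  · rfl
  · exact (hp.not_gt hq).elim
  · exact (hp.false).elim

theorem ofList_principalMinor (K : Type*) [Field K] {n : ℕ} {l : List (Finset (Fin n))}
    (hl : ∀ s ∈ l, s.card = 2) :
    Ideal.ofList (l.map (principalMinor (Matrix.mvPolynomialX (Fin n) (Fin n) K))) =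
      pairMinorIdeal K (increasingPairs l) := by
  rw [Ideal.ofList, pairMinorIdeal]
  congr 1
  ext f
  simp only [Set.mem_ofPred_eq, List.mem_map, Set.mem_image, SetLike.mem_coe]
  constructor
  · rintro ⟨s, hs, rfl⟩
    obtain ⟨p, hp, rfl, h⟩ := principalMinor_eq_pairMinor K (hl s hs)
    exact ⟨p, mem_increasingPairs.2 ⟨hp, hs⟩, h.symm⟩
  · rintro ⟨p, hp, rfl⟩
    obtain ⟨hlt, hmem⟩ := mem_increasingPairs.1 hp
    obtain ⟨q, hq, hpq, h⟩ := principalMinor_eq_pairMinor K (hl _ hmem)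
    exact ⟨_, hmem, by rw [h, eq_of_pair_eq_pair hlt hq hpq]⟩

theorem isRegular_principalMinor (K : Type*) [Field K] {n : ℕ} {l : List (Finset (Fin n))}
    (hnd : l.Nodup) (hl : ∀ s ∈ l, s.card = 2) :
    RingTheory.Sequence.IsRegular (MvPolynomial (Fin n × Fin n) K)
      (l.map (principalMinor (Matrix.mvPolynomialX (Fin n) (Fin n) K))) := by
  refine ⟨⟨fun i hi => ?_⟩, ?_⟩
  · rw [List.length_map] at hi
    have hl' : ∀ s ∈ l.take i, s.card = 2 := fun s hs => hl s (List.mem_of_mem_take hs)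
    have hprime := pairMinorIdeal_isPrime K (lt_of_mem_increasingPairs (l := l.take i))
    obtain ⟨p, hp, hpi, h⟩ := principalMinor_eq_pairMinor K (hl _ (List.getElem_mem hi))
    have hnot : p ∉ increasingPairs (l.take i) := by
      intro hmem
      have h1 := (mem_increasingPairs.1 hmem).2
      rw [← hpi, List.mem_take_iff_getElem] at h1
      obtain ⟨j, hj, hji⟩ := h1
      have := (hnd.getElem_inj_iff).1 hji
      omega
    have hnotMem := pairMinor_notMem K lt_of_mem_increasingPairs hp hnot
    rw [List.getElem_map, ← List.map_take, ofList_principalMinor K hl', h, smul_eq_mul,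
      Ideal.mul_top, isSMulRegular_quotient_iff_mem_of_smul_mem]
    -- Modulo a prime ideal, an element outside it is a nonzerodivisor.
    intro x hx
    exact (hprime.mem_or_mem hx).resolve_left hnotMem
  · rw [ofList_principalMinor K hl, smul_eq_mul, Ideal.mul_top]
    exact (pairMinorIdeal_isPrime K lt_of_mem_increasingPairs).ne_top.symm

theorem ofList_eq_genericPrincipalMinorIdeal (K : Type*) [Field K] {n t : ℕ}
    {l : List (Finset (Fin n))} (hl : ∀ s, s ∈ l ↔ s.card = t) :
    Ideal.ofList (l.map (principalMinor (Matrix.mvPolynomialX (Fin n) (Fin n) K))) =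
      genericPrincipalMinorIdeal K n t := by
  simp [Ideal.ofList, genericPrincipalMinorIdeal, principalMinorIdeal, hl]

theorem theorem2p1 (K : Type*) [Field K] [IsAlgClosed K] (n : ℕ) :
    IsCompleteIntersection K
        (MvPolynomial (Fin n × Fin n) K ⧸ genericPrincipalMinorIdeal K n 2) ∧
      IsDomain (MvPolynomial (Fin n × Fin n) K ⧸ genericPrincipalMinorIdeal K n 2) ∧
      -- the principal 2-minors, listed once each in any order, form a regular sequence
      (∀ l : List (Finset (Fin n)), l.Nodup → (∀ s : Finset (Fin n), s ∈ l ↔ s.card = 2) →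
        RingTheory.Sequence.IsRegular (MvPolynomial (Fin n × Fin n) K)
          (l.map (principalMinor (Matrix.mvPolynomialX (Fin n) (Fin n) K)))) ∧
      IsToricIdeal (genericPrincipalMinorIdeal K n 2) := by
  let l : List (Finset (Fin n)) := ({s | s.card = 2} : Finset (Finset (Fin n))).toList
  have hl : ∀ s : Finset (Fin n), s ∈ l ↔ s.card = 2 := by simp [l]
  have heq := ofList_eq_genericPrincipalMinorIdeal K hl
  have heq' := heq.symm.trans (ofList_principalMinor K fun s => (hl s).1)
  refine ⟨⟨_, inferInstance, _, isRegular_principalMinor K (Finset.nodup_toList _)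
    fun s => (hl s).1, ⟨Ideal.quotientEquivAlgOfEq K heq⟩⟩, ?_,
    fun l hnd hl => isRegular_principalMinor K hnd fun s => (hl s).1, ?_⟩
  · rw [Ideal.Quotient.isDomain_iff_prime, heq']
    exact pairMinorIdeal_isPrime K lt_of_mem_increasingPairs
  · rw [heq']
    exact pairMinorIdeal_isToric K lt_of_mem_increasingPairs
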